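/- **Setting.** In each of $T$ periods one customer arrives; independently across periods it is of type $j\in\{1,\dots,k\}$ with probability $\lambda_j$. Each arrival is irrevocably accepted (revenue $v_j$) or rejected. After period $T$ every accepted type-$j$ customer shows up independently with probability $p_j$, and a compensation of $1$ is paid for each customer showing up in excess of the capacity $B$. If $x_j$ type-$j$ customers are accepted in total, the expected profit is $$\mathcal P(x)=\sum_j v_jx_j-\mathbb E\Big[\Big(\sum_j \mathrm{Bin}(x_j,p_j)-B\Big)^+\Big]$$ with independent binomials. For an arrival vector $A$ with $N_j(A)$ arrivals of type $j$, the clairvoyant optimum is $\mathrm{OPT}_A=\max\{\mathcal P(x): x\in\mathbb Z^k,\ 0\le x_j\le N_j(A)\ \forall j\}$. **DLP policy.** Consider the linear program: maximize $\sum_j v_jz_j-\sum_j w_j$ subject to $\sum_j(p_jz_j-w_j)\le B$, $z_j\le T\lambda_j$, $w_j\le p_jz_j$, $z_j,w_j\ge 0$. Let $\Pi^\star$ be the value, in an optimal dual solution, of the dual variable of its first constraint. The DLP policy accepts an arrival of type $j$ iff $v_j\ge p_j\Pi^\star$. It is simulated on $M\ge1$ independent arrival vectors; with $x_j^m$ the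 number of type-$j$ customers accepted in the $m$-th simulation, set $\alpha_j=\sum_m x_j^m\big/\sum_m\sum_{i}x_{i}^m$. **DPD policy (Erdelyi–Topaloglu).** For $n\in\mathbb N$ let $\Gamma_\alpha(n)$ be a sum of $k$ independent random variables, the $j$-th of which has law $\mathrm{Bin}(\lfloor n\alpha_j\rfloor,p_j)$ with probability $\lfloor n\alpha_j\rfloor+1-n\alpha_j$ and $\mathrm{Bin}(\lceil n\alpha_j\rceil,p_j)$ otherwise. Put $U_{T+1}(n)=-\mathbb E[(\Gamma_\alpha(n)-B)^+]$ and $U_t(n)=\sum_j\lambda_j\max\{v_j+U_{t+1}(n+1),\,U_{t+1}(n)\}$ for $1\le t\le T$. When $n$ customers have been accepted before period $t$, the DPD policy accepts the period-$t$ arrival, of type $j$, iff $v_j\ge U_{t+1}(n)-U_{t+1}(n+1)$. Its loss is $\mathbb E[\mathrm{OPT}_A-\mathcal P(x^{\mathrm{DPD}})]$, where $x^{\mathrm{DPD}}$ is the vector of customers it accepts on $A$, and the expectation is over the arrival vector $A$ and the simulated arrival vectors, which are independent of $A$. **Proposition.** When the show-up probabilities are not all equal, the loss of the DPD policy can be of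 order $\Omega(T)$. Precisely, let $0<\varepsilon<\tfrac12$ and consider the two-type instance with $p_1=1$, $p_2=0$, $v_1=\tfrac12$, $v_2=\varepsilon$, $\lambda_1=\tfrac45$, $\lambda_2=\tfrac15$ and capacity $B=T/2$. Then an optimal dual value $\Pi^\star$ exists for every $T$, and there are $c>0$ and $T_0$ such that for all $T\ge T_0$, all $M\ge1$ and every optimal dual value $\Pi^\star$, the loss of the DPD policy is at least $cT$. -/

import Mathlib

noncomputable section

namespace Overbooking

open MeasureTheory

/-- The customer types: arrival probabilities, values (revenues) and show-up probabilities. -/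
structure Model (k : ℕ) where
  arrProb : Fin k → ℝ
  value : Fin k → ℝ
  showProb : Fin k → unitInterval
  arrProb_pos : ∀ j, 0 < arrProb j
  arrProb_sum : ∑ j, arrProb j = 1
  value_pos : ∀ j, 0 < value j
  value_lt_one : ∀ j, value j < 1

variable {k : ℕ}

/-! ### Arrivals -/

/-- The law of the type of one arrival. -/
def Model.typeLaw (S : Model k) : Measure (Fin k) :=
  ∑ j, ENNReal.ofReal (S.arrProb j) • Measure.dirac j

/-- The law of the vector of the types of `T` independent arrivals. -/
def Model.arrivalLaw (S : Model k) (T : ℕ) : Measure (Fin T → Fin k) :=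
  Measure.pi fun _ => S.typeLaw

/-- The law of `M` independent arrival vectors (used for the simulation). -/
def Model.simulationLaw (S : Model k) (M T : ℕ) : Measure (Fin M → Fin T → Fin k) :=
  Measure.pi fun _ => S.arrivalLaw T

/-- The number of arrivals of each type in an arrival vector. -/
def arrivalCount {T : ℕ} (A : Fin T → Fin k) (j : Fin k) : ℕ :=
  (Finset.univ.filter fun t => A t = j).card

/-! ### Objective and clairvoyant benchmark -/

/-- `𝔼[(∑ j, Y j - B)⁺]` for independent random variables `Y j` with laws `μ j`. -/
def expectedExcess (B : ℝ) (μ : Fin k → Measure ℕ) : ℝ :=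
  ∫ y, max (((∑ j, y j : ℕ) : ℝ) - B) 0 ∂(Measure.pi μ)

/-- The expected profit (revenue minus expected compensation) when `x j` customers of each type
`j` have been accepted and the capacity is `B`; each accepted customer of type `j` shows up
independently with probability `showProb j`, and compensation is `1` per customer above `B`. -/
def Model.profit (S : Model k) (B : ℝ) (x : Fin k → ℕ) : ℝ :=
  ∑ j, S.value j * x j -
    expectedExcess B fun j => ProbabilityTheory.binomial (x j) (S.showProb j)

/-- The clairvoyant optimum: the largest expected profit of a vector of accepted customers that
respects the actual numbers of arrivals. -/
def Model.opt (S : Model k) (B : ℝ) {T : ℕ} (A : Fin T → Fin k) : ℝ :=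
  (Finset.Icc (0 : Fin k → ℕ) (arrivalCount A)).sup'
    (Finset.nonempty_Icc.mpr (fun _ => Nat.zero_le _)) (S.profit B)

/-! ### Online policies -/

open Classical in
/-- The numbers `x j [t]` of customers of each type accepted among the first `t` arrivals by the
online policy that accepts, when `n` arrivals came before and `x` is the vector of customers
accepted so far, an arriving customer of type `j` if and only if `accept n x j`. -/
def acceptedCount (accept : ℕ → (Fin k → ℕ) → Fin k → Prop) {T : ℕ} (A : Fin T → Fin k) :
    ℕ → Fin k → ℕ
  | 0 => 0
  | t + 1 =>
    let x := acceptedCount accept A t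
    if h : t < T then
      if accept t x (A ⟨t, h⟩) then x + Pi.single (A ⟨t, h⟩) 1 else x
    else x

/-! ### Linear programs and their duals -/

/-- `y` is an optimal solution of `min b ⬝ y` subject to `c ≤ Aᵀ y`, `0 ≤ y`, the dual of the
linear program `max c ⬝ x` subject to `A x ≤ b`, `0 ≤ x`. -/
def IsDualOptimal {m n : Type*} [Fintype m] [Fintype n] (A : Matrix m n ℝ) (b : m → ℝ)
    (c : n → ℝ) (y : m → ℝ) : Prop :=
  (0 ≤ y ∧ c ≤ A.transpose.mulVec y) ∧
    ∀ y' : m → ℝ, 0 ≤ y' → c ≤ A.transpose.mulVec y' → b ⬝ᵥ y ≤ b ⬝ᵥ y'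

/-! ### The DLP policy

The deterministic linear program has variables `z j` (`Sum.inl j`) and `w j` (`Sum.inr j`):
maximize `∑ j, v j * z j - ∑ j, w j` subject to `∑ j, (p j * z j - w j) ≤ B` (row `Sum.inl ()`),
`z j ≤ T * lam j` (rows `Sum.inr (Sum.inl j)`), `w j ≤ p j * z j` (rows `Sum.inr (Sum.inr j)`)
and `0 ≤ z j`, `0 ≤ w j`. -/

/-- Constraint matrix of the deterministic linear program. -/
def Model.dlpMatrix (S : Model k) : Matrix (Unit ⊕ (Fin k ⊕ Fin k)) (Fin k ⊕ Fin k) ℝ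
  | Sum.inl _, Sum.inl j => S.showProb j
  | Sum.inl _, Sum.inr _ => -1
  | Sum.inr (Sum.inl i), Sum.inl j => if i = j then 1 else 0
  | Sum.inr (Sum.inl _), Sum.inr _ => 0
  | Sum.inr (Sum.inr i), Sum.inl j => if i = j then -(S.showProb j : ℝ) else 0
  | Sum.inr (Sum.inr i), Sum.inr j => if i = j then 1 else 0

/-- Right-hand side of the deterministic linear program. -/
def Model.dlpRhs (S : Model k) (B : ℝ) (T : ℕ) : Unit ⊕ (Fin k ⊕ Fin k) → ℝ
  | Sum.inl _ => B
  | Sum.inr (Sum.inl j) => T * S.arrProb j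
  | Sum.inr (Sum.inr _) => 0

/-- Objective vector of the deterministic linear program. -/
def Model.dlpObj (S : Model k) : Fin k ⊕ Fin k → ℝ
  | Sum.inl j => S.value j
  | Sum.inr _ => -1

/-- `Π` is the value, in some optimal dual solution of the deterministic linear program, of the
dual variable of the capacity constraint. -/
def Model.IsDualPrice (S : Model k) (B : ℝ) (T : ℕ) (price : ℝ) : Prop :=
  ∃ y, IsDualOptimal S.dlpMatrix (S.dlpRhs B T) S.dlpObj y ∧ y (Sum.inl ()) = price

/-- The DLP policy with dual price `Π` accepts type `j` if and only if `v j ≥ p j * Π`. -/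
def Model.dlpAccept (S : Model k) (price : ℝ) (_ : ℕ) (_ : Fin k → ℕ) (j : Fin k) : Prop :=
  S.showProb j * price ≤ S.value j

/-- The estimated fraction `α j` of type `j` among the customers accepted by the DLP policy in the
`M` simulated arrival vectors `A' m`. -/
def Model.fraction (S : Model k) (price : ℝ) {M T : ℕ} (A' : Fin M → Fin T → Fin k)
    (j : Fin k) : ℝ :=
  (∑ m, (acceptedCount (S.dlpAccept price) (A' m) T j : ℝ)) /
    ∑ m, ∑ i, (acceptedCount (S.dlpAccept price) (A' m) T i : ℝ)

/-! ### The DPD policy -/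

/-- The law of the number of type `j` customers that show up in the aggregated model with `n`
accepted customers: `Bin(⌊n α j⌋, p j)` with probability `⌊n α j⌋ + 1 - n α j`, and
`Bin(⌈n α j⌉, p j)` otherwise. -/
def Model.aggregateLaw (S : Model k) (α : Fin k → ℝ) (n : ℕ) (j : Fin k) : Measure ℕ :=
  ENNReal.ofReal (⌊n * α j⌋₊ + 1 - n * α j) •
      ProbabilityTheory.binomial ⌊n * α j⌋₊ (S.showProb j) +
    ENNReal.ofReal (n * α j - ⌊n * α j⌋₊) •
      ProbabilityTheory.binomial ⌈n * α j⌉₊ (S.showProb j)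

/-- The DPD value function, indexed by the number of arrivals that are still to come; its
arguments are this number and the total number `n` of customers accepted so far. -/
def Model.dpdValue (S : Model k) (B : ℝ) (α : Fin k → ℝ) : ℕ → ℕ → ℝ
  | 0, n => -expectedExcess B (S.aggregateLaw α n)
  | s + 1, n =>
    ∑ j, S.arrProb j * max (S.value j + S.dpdValue B α s (n + 1)) (S.dpdValue B α s n)

/-- The DPD policy accepts type `j` if and only if the value of `j` is at least the decrease of the
value function, at the remaining periods, that is caused by one more accepted customer. -/
def Model.dpdAccept (S : Model k) (B : ℝ) (T : ℕ) (α : Fin k → ℝ) (t : ℕ) (x : Fin k → ℕ)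
    (j : Fin k) : Prop :=
  S.dpdValue B α (T - (t + 1)) (∑ i, x i) - S.dpdValue B α (T - (t + 1)) ((∑ i, x i) + 1)
    ≤ S.value j

/-- The expected profit of the DPD policy with fractions `α` on the arrival vector `A`. -/
def Model.dpdProfit (S : Model k) (B : ℝ) (α : Fin k → ℝ) {T : ℕ} (A : Fin T → Fin k) : ℝ :=
  S.profit B (acceptedCount (S.dpdAccept B T α) A T)

/-- The expected loss, against the clairvoyant optimum, of the DPD policy whose fractions are
estimated from `M` simulations of the DLP policy with dual price `Π`; the expectation is over the
simulated arrival vectors and the (independent) actual arrival vector. -/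
def Model.dpdLoss (S : Model k) (B : ℝ) (T M : ℕ) (price : ℝ) : ℝ :=
  ∫ ω, (S.opt B ω.2 - S.dpdProfit B (S.fraction price ω.1) ω.2)
    ∂((S.simulationLaw M T).prod (S.arrivalLaw T))

/-! ### The two-type instance -/

/-- Type `1` (index `0`): arrival probability `4/5`, value `1/2`, always shows up.
Type `2` (index `1`): arrival probability `1/5`, value `ε`, never shows up. -/
def twoTypeModel (ε : ℝ) (h0 : 0 < ε) (h1 : ε < 1 / 2) : Model 2 where
  arrProb := ![4 / 5, 1 / 5]
  value := ![1 / 2, ε]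
  showProb := ![1, 0]
  arrProb_pos := by intro j; fin_cases j <;> norm_num
  arrProb_sum := by norm_num [Fin.sum_univ_two]
  value_pos := by intro j; fin_cases j <;> simp [h0]
  value_lt_one := by
    intro j
    fin_cases j
    · norm_num
    · simpa using h1.trans (by norm_num)

end Overbooking

end

/-!
The DLP has the unique dual price `1/2` for `T > 0`, because the expected demand `4/5 * T` for the
first type exceeds the capacity `T/2`. At this price the DLP policy accepts everybody, so `α 0` is
the empirical frequency of the first type and is close to `4/5`.

In the aggregated model an accepted customer of either type uses `α 0 > 1/2` units of capacity.
Once `n * α 0` is above the capacity, the value function is exactly `B - n * α 0`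
(`twoTypeModel_dpdValue`): an acceptance costs more than either revenue, and the DPD policy rejects
everybody. Hence it accepts at most about `T / (2 * α 0)`, that is `5/8 * T`, customers in total.

This forces a linear loss (`twoTypeModel_loss_of_typical`). If the number of accepted customers of
the first type differs linearly from the capacity `T/2`, the benchmark gains `1/2` for each unit of
the difference. Otherwise about `T/8` customers of the second type at most are accepted, although
about `T/5` of them arrive, never show up, and are worth `ε` each.

The loss is never negative, so it is enough that this happens with a probability bounded away from
zero. It is convenient to bound the loss below, on every sample path, by a multiple of `T` times
one minus quadratic error terms in `α 0` and in the number of arrivals of the first type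
(`twoTypeModel_loss_ge`). Their expectations are variances of order `1/T`, uniformly in the number
`M` of simulations.
-/

open MeasureTheory ProbabilityTheory

namespace Overbooking


/-! ### Policies -/

variable {k : ℕ}

lemma card_filter_lt_succ {T : ℕ} (A : Fin T → Fin k) {t : ℕ} (ht : t < T) (j : Fin k) :
    (Finset.univ.filter fun i : Fin T => (i : ℕ) < t + 1 ∧ A i = j).card =
      (Finset.univ.filter fun i : Fin T => (i : ℕ) < t ∧ A i = j).card +
        (Pi.single (A ⟨t, ht⟩) 1 : Fin k → ℕ) j := by
  simp only [Finset.card_filter, Pi.single_apply]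
  rw [← Fintype.sum_ite_eq (⟨t, ht⟩ : Fin T) fun i => if j = A i then 1 else 0,
    ← Finset.sum_add_distrib]
  refine Finset.sum_congr rfl fun i _ => ?_
  by_cases hi : (i : ℕ) = t
  · obtain rfl : (⟨t, ht⟩ : Fin T) = i := Fin.ext hi.symm
    simp [eq_comm]
  · have h1 : ¬ (⟨t, ht⟩ : Fin T) = i := fun h => hi (by rw [← h])
    have h2 : (i : ℕ) < t + 1 ↔ (i : ℕ) < t := by omega
    simp [h1, h2]

lemma acceptedCount_le_arrivalCount (accept : ℕ → (Fin k → ℕ) → Fin k → Prop) {T : ℕ}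
    (A : Fin T → Fin k) : acceptedCount accept A T ≤ arrivalCount A := by
  have key : ∀ t ≤ T, ∀ j, acceptedCount accept A t j ≤
      (Finset.univ.filter fun i : Fin T => (i : ℕ) < t ∧ A i = j).card := by
    intro t
    induction t with
    | zero => intro _ j; simp [acceptedCount]
    | succ t ih =>
      intro ht j
      have := ih (by omega) j
      rw [card_filter_lt_succ A ht]
      simp only [acceptedCount, dif_pos (show t < T from ht)]
      split_ifs
      · simpa using this
      · exact this.trans (Nat.le_add_right _ _)
  intro j
  simpa [arrivalCount] using key T le_rfl j

lemma acceptedCount_of_forall_accept {accept : ℕ → (Fin k → ℕ) → Fin k → Prop}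
    (h : ∀ t x j, accept t x j) {T : ℕ} (A : Fin T → Fin k) :
    acceptedCount accept A T = arrivalCount A := by
  have key : ∀ t ≤ T, ∀ j, acceptedCount accept A t j =
      (Finset.univ.filter fun i : Fin T => (i : ℕ) < t ∧ A i = j).card := by
    intro t
    induction t with
    | zero => intro _ j; simp [acceptedCount]
    | succ t ih =>
      intro ht j
      rw [card_filter_lt_succ A ht, ← ih (by omega) j]
      simp [acceptedCount, show t < T from ht, h]
  ext j
  simpa [arrivalCount] using key T le_rfl j

lemma sum_arrivalCount {T : ℕ} (A : Fin T → Fin k) : ∑ j, arrivalCount A j = T := by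
  simp only [arrivalCount]
  simpa using (Finset.card_eq_sum_card_fiberwise (f := A) (s := Finset.univ)
    (t := Finset.univ) (fun _ _ => by simp)).symm

/-- Every vector of accepted customers that respects the arrivals bounds the benchmark below. In
particular, no online policy has a negative loss on any arrival vector. -/
lemma Model.profit_le_opt (S : Model k) (B : ℝ) {T : ℕ} {A : Fin T → Fin k} {x : Fin k → ℕ}
    (hx : x ≤ arrivalCount A) : S.profit B x ≤ S.opt B A :=
  Finset.le_sup' (S.profit B) (Finset.mem_Icc.mpr ⟨fun _ => Nat.zero_le _, hx⟩)

/-- If a policy rejects whenever at least `N` customers have been accepted, it accepts at most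
`N` customers in total. -/
lemma sum_acceptedCount_le {accept : ℕ → (Fin k → ℕ) → Fin k → Prop} {N : ℕ}
    (h : ∀ t x j, N ≤ ∑ i, x i → ¬ accept t x j) {T : ℕ} (A : Fin T → Fin k) (t : ℕ) :
    ∑ i, acceptedCount accept A t i ≤ N := by
  induction t with
  | zero => simp [acceptedCount]
  | succ t ih =>
    simp only [acceptedCount]
    split_ifs with h1 h2
    · have h3 : ¬ N ≤ ∑ i, acceptedCount accept A t i := fun h' => h _ _ _ h' h2
      simp only [Pi.add_apply, Finset.sum_add_distrib, Finset.mem_univ, if_true,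
        Pi.single_apply, Finset.sum_ite_eq']
      omega
    · exact ih
    · exact ih

/-! ### Laws of arrivals -/

instance (S : Model k) : IsProbabilityMeasure S.typeLaw := by
  constructor
  simp only [Model.typeLaw, Measure.coe_finsetSum, Finset.sum_apply, Measure.smul_apply,
    measure_univ, smul_eq_mul, mul_one]
  rw [← ENNReal.ofReal_sum_of_nonneg fun j _ => (S.arrProb_pos j).le, S.arrProb_sum,
    ENNReal.ofReal_one]

instance (S : Model k) (T : ℕ) : IsProbabilityMeasure (S.arrivalLaw T) := by
  unfold Model.arrivalLaw; infer_instance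

instance (S : Model k) (M T : ℕ) : IsProbabilityMeasure (S.simulationLaw M T) := by
  unfold Model.simulationLaw; infer_instance

lemma Model.integral_typeLaw (S : Model k) (f : Fin k → ℝ) :
    ∫ i, f i ∂S.typeLaw = ∑ j, S.arrProb j * f j := by
  rw [Model.typeLaw, integral_finsetSum_measure fun _ _ => by
    exact (integrable_dirac (by simp)).smul_measure ENNReal.ofReal_ne_top]
  refine Finset.sum_congr rfl fun j _ => ?_
  rw [integral_smul_measure, integral_dirac, ENNReal.toReal_ofReal (S.arrProb_pos j).le,
    smul_eq_mul]

/-- The number of arrivals of type `j` is binomial, with variance `T * lam j * (1 - lam j)`. -/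
lemma Model.integral_sq_arrivalCount_sub (S : Model k) (T : ℕ) (j : Fin k) :
    ∫ A, ((arrivalCount A j : ℝ) - T * S.arrProb j) ^ 2 ∂S.arrivalLaw T =
      T * (S.arrProb j * (1 - S.arrProb j)) := by
  set X : Fin k → ℝ := fun i => if i = j then 1 else 0 with hX
  have hLp : ∀ _ : Fin T, MemLp X 2 S.typeLaw := fun _ => MemLp.of_discrete
  have hmean : ∫ i, X i ∂S.typeLaw = S.arrProb j := by
    simp [S.integral_typeLaw, hX]
  have hvar : Var[X; S.typeLaw] = S.arrProb j * (1 - S.arrProb j) := by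
    rw [variance_eq_sub MemLp.of_discrete]
    simp [S.integral_typeLaw, hX]
    ring
  have hcount : ∀ A : Fin T → Fin k, (arrivalCount A j : ℝ) =
      (∑ t, fun A : Fin T → Fin k => X (A t)) A := by
    intro A
    simp [arrivalCount, hX]
  have h := variance_sum_pi (μ := fun _ : Fin T => S.typeLaw) (X := fun _ => X) hLp
  rw [variance_eq_integral (by exact (measurable_of_finite _).aemeasurable)] at h
  have hE : ∫ A, (∑ t, fun A : Fin T → Fin k => X (A t)) A ∂(Measure.pi fun _ : Fin T => S.typeLaw)
      = T * S.arrProb j := by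
    simp only [Finset.sum_apply]
    rw [integral_finsetSum _ fun _ _ => Integrable.of_finite]
    simp [integral_comp_eval (μ := fun _ : Fin T => S.typeLaw) (f := X)
      (measurable_of_finite X).aestronglyMeasurable, hmean]
  rw [hE] at h
  simp only [hcount, Model.arrivalLaw, h, hvar]
  simp


/-! ### Profit and value function of the two-type instance -/

lemma binomial_prob_zero (n : ℕ) : binomial n 0 = Measure.dirac 0 := by
  simp [binomial]

lemma binomial_prob_one (n : ℕ) : binomial n 1 = Measure.dirac n := by
  simp [binomial]

lemma expectedExcess_fin_two {B : ℝ} {μ : Fin 2 → Measure ℕ} [∀ i, SigmaFinite (μ i)]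
    (h : μ 1 = Measure.dirac 0) : expectedExcess B μ = ∫ y, max ((y : ℝ) - B) 0 ∂μ 0 := by
  have h1 := (measurePreserving_piFinTwo μ).integral_comp'
    (g := fun y : ℕ × ℕ => max (((y.1 + y.2 : ℕ) : ℝ) - B) 0)
  rw [expectedExcess]
  simp only [Fin.sum_univ_two]
  refine h1.trans ?_
  rw [h, Measure.prod_dirac, integral_map (by fun_prop)
    (measurable_of_countable _).aestronglyMeasurable]
  simp

section TwoType

variable {ε : ℝ} {h0 : 0 < ε} {h1 : ε < 1 / 2}

lemma twoTypeModel_profit (B : ℝ) (x : Fin 2 → ℕ) :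
    (twoTypeModel ε h0 h1).profit B x = x 0 / 2 + ε * x 1 - max (x 0 - B) 0 := by
  rw [Model.profit, expectedExcess_fin_two (by simp [twoTypeModel, binomial_prob_zero])]
  simp [twoTypeModel, binomial_prob_one, Fin.sum_univ_two]
  ring

/-- Above the capacity the aggregated model is deterministic on average: each accepted customer
counts as `α 0` customers who show up. -/
lemma twoTypeModel_expectedExcess_aggregateLaw {B : ℝ} {α : Fin 2 → ℝ} (hα : 0 ≤ α) {n : ℕ}
    (hn : B ≤ ⌊n * α 0⌋₊) :
    expectedExcess B ((twoTypeModel ε h0 h1).aggregateLaw α n) = n * α 0 - B := by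
  have hpos : ∀ j, 0 ≤ n * α j := fun j => mul_nonneg n.cast_nonneg (hα j)
  have hfloor : ∀ j, (⌊n * α j⌋₊ : ℝ) ≤ n * α j := fun j => Nat.floor_le (hpos j)
  have hlt : ∀ j, n * α j < ⌊n * α j⌋₊ + 1 := fun j => Nat.lt_floor_add_one _
  have hfin : ∀ j, IsFiniteMeasure ((twoTypeModel ε h0 h1).aggregateLaw α n j) := by
    intro j
    unfold Model.aggregateLaw
    have := fun r : ℝ => fun μ : Measure ℕ => fun _ : IsFiniteMeasure μ =>
      μ.smul_finite (ENNReal.ofReal_ne_top (r := r))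
    have i1 := this (⌊n * α j⌋₊ + 1 - n * α j) (binomial ⌊n * α j⌋₊
      ((twoTypeModel ε h0 h1).showProb j)) inferInstance
    have i2 := this (n * α j - ⌊n * α j⌋₊) (binomial ⌈n * α j⌉₊
      ((twoTypeModel ε h0 h1).showProb j)) inferInstance
    infer_instance
  rw [expectedExcess_fin_two]
  · have hint : ∀ (r : ℝ) (m : ℕ), Integrable (fun y : ℕ => max ((y : ℝ) - B) 0)
        (ENNReal.ofReal r • Measure.dirac m) := fun r m =>
      (integrable_dirac (by simp)).smul_measure ENNReal.ofReal_ne_top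
    have hp : (twoTypeModel ε h0 h1).showProb 0 = 1 := rfl
    simp only [Model.aggregateLaw, hp, binomial_prob_one]
    rw [integral_add_measure (hint _ _) (hint _ _), integral_smul_measure, integral_smul_measure,
      integral_dirac, integral_dirac, ENNReal.toReal_ofReal (by linarith [hlt 0]),
      ENNReal.toReal_ofReal (by linarith [hfloor 0])]
    have hc : (⌊n * α 0⌋₊ : ℝ) ≤ ⌈n * α 0⌉₊ := by exact_mod_cast Nat.floor_le_ceil _
    rw [max_eq_left (by linarith), max_eq_left (by linarith), smul_eq_mul, smul_eq_mul]
    -- either the floor and the ceiling differ by one, or the second weight vanishes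
    have hkey : (n * α 0 - ⌊n * α 0⌋₊) * ((⌈n * α 0⌉₊ : ℝ) - ⌊n * α 0⌋₊ - 1) = 0 := by
      rcases (hfloor 0).eq_or_lt with h | h
      · rw [← h]; simp
      · have h2 : ⌊n * α 0⌋₊ < ⌈n * α 0⌉₊ := Nat.lt_ceil.mpr h
        have h3 := Nat.ceil_le_floor_add_one (n * α 0)
        have h4 : ⌈n * α 0⌉₊ = ⌊n * α 0⌋₊ + 1 := by omega
        rw [h4]; push_cast; ring
    linear_combination hkey
  · have hp : (twoTypeModel ε h0 h1).showProb 1 = 0 := rfl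
    rw [Model.aggregateLaw, hp, binomial_prob_zero, binomial_prob_zero, ← add_smul,
      ← ENNReal.ofReal_add (by linarith [hlt 1]) (by linarith [hfloor 1])]
    simp

/-- Once the aggregated number of customers showing up exceeds the capacity, a further acceptance
costs `α 0`, which exceeds both revenues, so it is optimal in the aggregated model to stop. -/
lemma twoTypeModel_dpdValue {B : ℝ} {α : Fin 2 → ℝ} (hα : 0 ≤ α) (hα0 : 1 / 2 < α 0) (s : ℕ) :
    ∀ {n : ℕ}, B ≤ ⌊n * α 0⌋₊ → (twoTypeModel ε h0 h1).dpdValue B α s n = B - n * α 0 := by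
  induction s with
  | zero =>
    intro n hn
    rw [Model.dpdValue, twoTypeModel_expectedExcess_aggregateLaw hα hn]
    ring
  | succ s ih =>
    intro n hn
    have hn' : B ≤ ⌊((n + 1 : ℕ) : ℝ) * α 0⌋₊ := hn.trans <| by
      have : n * α 0 ≤ ((n + 1 : ℕ) : ℝ) * α 0 := by push_cast; nlinarith
      exact_mod_cast Nat.floor_mono this
    rw [Model.dpdValue]
    simp only [ih hn, ih hn', Fin.sum_univ_two]
    rw [max_eq_right, max_eq_right]
    · simp [twoTypeModel]; ring
    · simp [twoTypeModel]; linarith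
    · simp [twoTypeModel]; linarith

lemma twoTypeModel_not_dpdAccept {B : ℝ} {α : Fin 2 → ℝ} (hα : 0 ≤ α) (hα0 : 1 / 2 < α 0)
    {T t : ℕ} {x : Fin 2 → ℕ} (hx : ⌈(B + 1) / α 0⌉₊ ≤ ∑ i, x i) (j : Fin 2) :
    ¬ (twoTypeModel ε h0 h1).dpdAccept B T α t x j := by
  have hfloor : ∀ n : ℕ, ⌈(B + 1) / α 0⌉₊ ≤ n → B ≤ ⌊n * α 0⌋₊ := by
    intro n hn
    have h2 : B + 1 ≤ n * α 0 := (div_le_iff₀ (by linarith)).mp (Nat.ceil_le.mp hn)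
    linarith [Nat.lt_floor_add_one (n * α 0)]
  rw [Model.dpdAccept, twoTypeModel_dpdValue hα hα0 _ (hfloor _ hx),
    twoTypeModel_dpdValue hα hα0 _ (hfloor _ (hx.trans (Nat.le_succ _)))]
  have hv : (twoTypeModel ε h0 h1).value j ≤ 1 / 2 := by
    fin_cases j <;> simp [twoTypeModel]
    linarith
  push_cast
  linarith

lemma twoTypeModel_dpdProfit_le_opt (B : ℝ) (α : Fin 2 → ℝ) {T : ℕ} (A : Fin T → Fin 2) :
    (twoTypeModel ε h0 h1).dpdProfit B α A ≤ (twoTypeModel ε h0 h1).opt B A :=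
  Model.profit_le_opt _ _ (acceptedCount_le_arrivalCount _ _)

/-- On typical arrivals, and for a fraction `α 0` that is not far below `4/5`, the loss is linear:
the total number of acceptances is at most about `2/3 * T`, so either the number of accepted
customers of the first type is far from the capacity `T/2`, or many customers of the second type
are rejected. -/
lemma twoTypeModel_loss_of_typical {α : Fin 2 → ℝ} (hα : 0 ≤ α) (hα0 : 3 / 4 ≤ α 0) {T : ℕ}
    (hT : 1000 ≤ T) {A : Fin T → Fin 2} (hlow : 79 / 100 * (T : ℝ) ≤ arrivalCount A 0)
    (hhigh : (arrivalCount A 0 : ℝ) ≤ 81 / 100 * T) :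
    ε / 125 * T ≤ (twoTypeModel ε h0 h1).opt (T / 2) A -
      (twoTypeModel ε h0 h1).dpdProfit (T / 2) α A := by
  set x := acceptedCount ((twoTypeModel ε h0 h1).dpdAccept (T / 2) T α) A T with hx
  have hxA : x ≤ arrivalCount A := acceptedCount_le_arrivalCount _ _
  have hT' : (1000 : ℝ) ≤ T := by exact_mod_cast hT
  have hsum : (arrivalCount A 0 : ℝ) + arrivalCount A 1 = T := by
    exact_mod_cast (Fin.sum_univ_two _).symm.trans (sum_arrivalCount A)
  have htot : (x 0 : ℝ) + x 1 ≤ 4 / 3 * (T / 2 + 1) + 1 := by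
    have h2 := sum_acceptedCount_le (fun t y j hy =>
      twoTypeModel_not_dpdAccept (ε := ε) (h0 := h0) (h1 := h1) (T := T) (t := t) (B := T / 2)
        hα (by linarith) (x := y) hy j) A T
    rw [Fin.sum_univ_two, ← hx] at h2
    have h3 : (x 0 : ℝ) + x 1 ≤ ⌈((T : ℝ) / 2 + 1) / α 0⌉₊ := by exact_mod_cast h2
    have h4 := Nat.ceil_lt_add_one (a := ((T : ℝ) / 2 + 1) / α 0) (by positivity)
    have h5 : ((T : ℝ) / 2 + 1) / α 0 ≤ 4 / 3 * (T / 2 + 1) := by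
      rw [div_le_iff₀ (by linarith)]
      nlinarith
    linarith
  have hd1 : 2 * ((T / 2 : ℕ) : ℝ) ≤ T := by
    exact_mod_cast (show 2 * (T / 2) ≤ T by omega)
  have hd2 : (T : ℝ) ≤ 2 * ((T / 2 : ℕ) : ℝ) + 1 := by
    exact_mod_cast (show T ≤ 2 * (T / 2) + 1 by omega)
  have hx0 : (x 0 : ℝ) ≤ arrivalCount A 0 := by exact_mod_cast hxA 0
  -- the benchmark fills the capacity with customers of the first type, or keeps `x 0`
  have hopt : ∀ y0 y1 : ℕ, y0 ≤ arrivalCount A 0 → y1 ≤ arrivalCount A 1 →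
      (y0 : ℝ) / 2 + ε * y1 - max ((y0 : ℝ) - (T : ℝ) / 2) 0 ≤
        (twoTypeModel ε h0 h1).opt (T / 2) A := by
    intro y0 y1 hy0 hy1
    have := (twoTypeModel ε h0 h1).profit_le_opt (T / 2) (A := A) (x := ![y0, y1])
      (by intro j; fin_cases j <;> simp [hy0, hy1])
    simpa [twoTypeModel_profit] using this
  have hhalf : T / 2 ≤ arrivalCount A 0 := by
    have : ((T / 2 : ℕ) : ℝ) ≤ arrivalCount A 0 := by linarith
    exact_mod_cast this
  have o1 := hopt (T / 2) (x 1) hhalf (hxA 1)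
  have o2 := hopt (x 0) (arrivalCount A 1) (hxA 0) le_rfl
  rw [max_eq_right (by linarith)] at o1
  rw [Model.dpdProfit, ← hx, twoTypeModel_profit]
  have hεT : ε / 125 * T ≤ 1 / 250 * T := by nlinarith
  have hm1 := le_max_left ((x 0 : ℝ) - T / 2) 0
  have hm2 := le_max_right ((x 0 : ℝ) - T / 2) 0
  by_cases ha : (T : ℝ) / 2 + T / 100 ≤ x 0
  · linarith
  by_cases hb : (x 0 : ℝ) ≤ T / 2 - T / 100
  · linarith
  push Not at ha hb
  have hgap : (T : ℝ) / 100 ≤ arrivalCount A 1 - x 1 := by linarith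
  nlinarith

/-! ### The dual price -/

/-- The solution of the dual linear program with price `1/2`. -/
noncomputable def twoTypeDual (ε : ℝ) : Unit ⊕ (Fin 2 ⊕ Fin 2) → ℝ :=
  Sum.elim (fun _ => 1 / 2) (Sum.elim ![0, ε] 0)

lemma twoTypeModel_dual_feasible_iff (y : Unit ⊕ (Fin 2 ⊕ Fin 2) → ℝ) :
    (twoTypeModel ε h0 h1).dlpObj ≤ (twoTypeModel ε h0 h1).dlpMatrix.transpose.mulVec y ↔
      1 / 2 ≤ y (.inl ()) + y (.inr (.inl 0)) - y (.inr (.inr 0)) ∧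
      ε ≤ y (.inr (.inl 1)) ∧
      -1 ≤ -y (.inl ()) + y (.inr (.inr 0)) ∧ -1 ≤ -y (.inl ()) + y (.inr (.inr 1)) := by
  simp [Pi.le_def, Matrix.mulVec, dotProduct, Model.dlpMatrix, Model.dlpObj, twoTypeModel,
    Fin.forall_fin_two, Fin.sum_univ_two, and_assoc, add_sub_assoc, ← sub_eq_add_neg]

lemma twoTypeModel_dlpRhs_dotProduct (T : ℕ) (y : Unit ⊕ (Fin 2 ⊕ Fin 2) → ℝ) :
    (twoTypeModel ε h0 h1).dlpRhs (T / 2) T ⬝ᵥ y =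
      T / 2 * y (.inl ()) + T * (4 / 5) * y (.inr (.inl 0)) + T * (1 / 5) * y (.inr (.inl 1)) := by
  simp [dotProduct, Model.dlpRhs, twoTypeModel, Fin.sum_univ_two, add_assoc]

lemma twoTypeModel_isDualOptimal_twoTypeDual (T : ℕ) :
    IsDualOptimal (twoTypeModel ε h0 h1).dlpMatrix ((twoTypeModel ε h0 h1).dlpRhs (T / 2) T)
      (twoTypeModel ε h0 h1).dlpObj (twoTypeDual ε) := by
  refine ⟨⟨?_, ?_⟩, ?_⟩
  · simp [Pi.le_def, twoTypeDual, Fin.forall_fin_two, h0.le]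
  · rw [twoTypeModel_dual_feasible_iff]
    norm_num [twoTypeDual]
  · intro y hy hfeas
    rw [twoTypeModel_dual_feasible_iff] at hfeas
    rw [twoTypeModel_dlpRhs_dotProduct, twoTypeModel_dlpRhs_dotProduct]
    have p1 : 0 ≤ y (.inr (.inl 0)) := hy _
    have p2 : 0 ≤ y (.inr (.inr 0)) := hy _
    have hT : (0 : ℝ) ≤ T := T.cast_nonneg
    have q1 := mul_le_mul_of_nonneg_left
      (show 1 / 2 ≤ y (.inl ()) + y (.inr (.inl 0)) by linarith) hT
    have q2 := mul_le_mul_of_nonneg_left hfeas.2.1 hT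
    have q3 := mul_nonneg hT p1
    simp only [twoTypeDual, Sum.elim_inl, Sum.elim_inr, Matrix.cons_val_zero, Matrix.cons_val_one]
    linarith

/-- The price `1/2` is the only optimal one: as `T/2 < 4/5 * T`, it is cheaper to raise the price of
capacity than the dual variable of the demand for the first type. -/
lemma twoTypeModel_dualPrice_eq {T : ℕ} (hT : 0 < T) {price : ℝ}
    (h : (twoTypeModel ε h0 h1).IsDualPrice (T / 2) T price) : price = 1 / 2 := by
  obtain ⟨y, ⟨⟨hy, hfeas⟩, hopt⟩, rfl⟩ := h
  obtain ⟨⟨hd, hdfeas⟩, -⟩ := twoTypeModel_isDualOptimal_twoTypeDual (h0 := h0) (h1 := h1) T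
  have hle := hopt _ hd hdfeas
  rw [twoTypeModel_dual_feasible_iff] at hfeas
  rw [twoTypeModel_dlpRhs_dotProduct, twoTypeModel_dlpRhs_dotProduct] at hle
  simp only [twoTypeDual, Sum.elim_inl, Sum.elim_inr, Matrix.cons_val_zero,
    Matrix.cons_val_one] at hle
  have p1 : 0 ≤ y (.inr (.inl 0)) := hy _
  have p2 : 0 ≤ y (.inr (.inr 0)) := hy _
  have hT' : (0 : ℝ) < T := by exact_mod_cast hT
  have hle' : 1 / 2 * y (.inl ()) + 4 / 5 * y (.inr (.inl 0)) + 1 / 5 * y (.inr (.inl 1)) ≤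
      1 / 4 + 1 / 5 * ε := by
    refine le_of_mul_le_mul_left ?_ hT'
    linarith
  linarith

/-! ### The estimated fractions -/

lemma twoTypeModel_fraction {M T : ℕ} (A' : Fin M → Fin T → Fin 2) (j : Fin 2) :
    (twoTypeModel ε h0 h1).fraction (1 / 2) A' j =
      (∑ m, (arrivalCount (A' m) j : ℝ)) / (M * T) := by
  have hacc : ∀ t x j, (twoTypeModel ε h0 h1).dlpAccept (1 / 2) t x j := by
    intro t x j
    fin_cases j <;> simp [Model.dlpAccept, twoTypeModel, h0.le]
  have hs : ∀ m, ∑ i, (arrivalCount (A' m) i : ℝ) = T := fun m => by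
    exact_mod_cast sum_arrivalCount (A' m)
  simp only [Model.fraction, acceptedCount_of_forall_accept hacc, hs]
  simp

/-- By convexity, the mean square error of the estimate is at most that of a single simulation. -/
lemma twoTypeModel_integral_sq_fraction_sub_le {M T : ℕ} (hM : 0 < M) (hT : 0 < T) :
    ∫ A', ((twoTypeModel ε h0 h1).fraction (1 / 2) A' 0 - 4 / 5) ^ 2
      ∂(twoTypeModel ε h0 h1).simulationLaw M T ≤ 4 / 25 / (T : ℝ) := by
  have hM' : (0 : ℝ) < M := by exact_mod_cast hM
  have hT' : (0 : ℝ) < T := by exact_mod_cast hT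
  have hpt : ∀ A' : Fin M → Fin T → Fin 2,
      ((twoTypeModel ε h0 h1).fraction (1 / 2) A' 0 - 4 / 5) ^ 2 ≤
        1 / (M * T ^ 2) * ∑ m, ((arrivalCount (A' m) 0 : ℝ) - T * (4 / 5)) ^ 2 := by
    intro A'
    have hcs := sq_sum_le_card_mul_sum_sq (s := Finset.univ)
      (f := fun m => (arrivalCount (A' m) 0 : ℝ) - T * (4 / 5))
    have heq : (twoTypeModel ε h0 h1).fraction (1 / 2) A' 0 - 4 / 5 =
        (∑ m, ((arrivalCount (A' m) 0 : ℝ) - T * (4 / 5))) / (M * T) := by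
      rw [twoTypeModel_fraction]
      simp only [Finset.sum_sub_distrib, Finset.sum_const, Finset.card_univ, Fintype.card_fin,
        nsmul_eq_mul]
      field_simp
    rw [heq, div_pow, div_le_iff₀ (by positivity)]
    refine hcs.trans (le_of_eq ?_)
    have hconst : ∀ s : ℝ, M * s = 1 / (M * (T : ℝ) ^ 2) * s * (M * T) ^ 2 := fun s => by
      field_simp
    rw [Finset.card_univ, Fintype.card_fin]
    exact hconst _
  refine (integral_mono .of_finite .of_finite hpt).trans (le_of_eq ?_)
  rw [integral_const_mul, integral_finsetSum _ fun _ _ => .of_finite]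
  have hone : ∀ m : Fin M, ∫ A' : Fin M → Fin T → Fin 2,
      ((arrivalCount (A' m) 0 : ℝ) - T * (4 / 5)) ^ 2 ∂(twoTypeModel ε h0 h1).simulationLaw M T =
        (T : ℝ) * (4 / 25) := by
    intro m
    rw [Model.simulationLaw, integral_comp_eval
      (μ := fun _ : Fin M => (twoTypeModel ε h0 h1).arrivalLaw T)
      (f := fun A => ((arrivalCount A 0 : ℝ) - T * (4 / 5)) ^ 2)
      (measurable_of_finite _).aestronglyMeasurable]
    refine ((twoTypeModel ε h0 h1).integral_sq_arrivalCount_sub T 0).trans ?_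
    norm_num [twoTypeModel]
  simp only [hone, Finset.sum_const, Finset.card_univ, Fintype.card_fin, nsmul_eq_mul]
  field_simp

/-! ### The expected loss -/

/-- The loss is nonnegative, and linear in `T` unless the quadratic error terms are large. -/
lemma twoTypeModel_loss_ge {α : Fin 2 → ℝ} (hα : 0 ≤ α) {T : ℕ} (hT : 1000 ≤ T)
    (A : Fin T → Fin 2) :
    ε / 125 * T * (1 - 400 * (α 0 - 4 / 5) ^ 2 -
        10000 / T ^ 2 * ((arrivalCount A 0 : ℝ) - T * (4 / 5)) ^ 2) ≤
      (twoTypeModel ε h0 h1).opt (T / 2) A - (twoTypeModel ε h0 h1).dpdProfit (T / 2) α A := by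
  have hT' : (1000 : ℝ) ≤ T := by exact_mod_cast hT
  have hc : 0 ≤ ε / 125 * T := by positivity
  set N : ℝ := (arrivalCount A 0 : ℝ)
  have hN : 0 ≤ 10000 / (T : ℝ) ^ 2 * (N - T * (4 / 5)) ^ 2 := by positivity
  have hsq : 0 ≤ (α 0 - 4 / 5) ^ 2 := sq_nonneg _
  by_cases hα0 : 3 / 4 ≤ α 0
  · by_cases hN1 : |N - T * (4 / 5)| ≤ T / 100
    · rw [abs_le] at hN1
      refine le_trans ?_ (twoTypeModel_loss_of_typical hα hα0 hT (A := A) (h0 := h0) (h1 := h1)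
        (by linarith) (by linarith))
      exact mul_le_of_le_one_right hc (by linarith)
    · have h2 : 1 ≤ 10000 / (T : ℝ) ^ 2 * (N - T * (4 / 5)) ^ 2 := by
        rw [div_mul_eq_mul_div, le_div_iff₀ (by positivity), ← sq_abs (N - T * (4 / 5))]
        nlinarith
      exact (mul_nonpos_of_nonneg_of_nonpos hc (by linarith)).trans
        (sub_nonneg.mpr (twoTypeModel_dpdProfit_le_opt _ _ _))
  · have h2 : 1 ≤ 400 * (α 0 - 4 / 5) ^ 2 := by nlinarith
    exact (mul_nonpos_of_nonneg_of_nonpos hc (by linarith)).trans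
      (sub_nonneg.mpr (twoTypeModel_dpdProfit_le_opt _ _ _))

lemma twoTypeModel_dpdLoss_ge {M T : ℕ} (hM : 0 < M) (hT : 4000 ≤ T) :
    ε / 250 * T ≤ (twoTypeModel ε h0 h1).dpdLoss (T / 2) T M (1 / 2) := by
  have hT' : (4000 : ℝ) ≤ T := by exact_mod_cast hT
  have hα : ∀ A' : Fin M → Fin T → Fin 2, 0 ≤ (twoTypeModel ε h0 h1).fraction (1 / 2) A' := by
    intro A' j
    rw [twoTypeModel_fraction]
    exact div_nonneg (Finset.sum_nonneg fun _ _ => Nat.cast_nonneg _) (by positivity)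
  have hvar := twoTypeModel_integral_sq_fraction_sub_le (h0 := h0) (h1 := h1) hM
    (show 0 < T by omega)
  have hvar' : ∫ A, ((arrivalCount A 0 : ℝ) - T * (4 / 5)) ^ 2
      ∂(twoTypeModel ε h0 h1).arrivalLaw T = (T : ℝ) * (4 / 25) := by
    refine ((twoTypeModel ε h0 h1).integral_sq_arrivalCount_sub T 0).trans ?_
    norm_num [twoTypeModel]
  set μ := (twoTypeModel ε h0 h1).simulationLaw M T
  set ν := (twoTypeModel ε h0 h1).arrivalLaw T
  have hmono := integral_mono (μ := μ.prod ν) .of_finite .of_finite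
    (fun ω => twoTypeModel_loss_ge (h0 := h0) (h1 := h1) (hα ω.1) (show 1000 ≤ T by omega) ω.2)
  refine le_trans ?_ hmono
  rw [integral_const_mul, integral_sub .of_finite .of_finite, integral_sub .of_finite .of_finite,
    integral_const_mul, integral_const_mul,
    integral_fun_fst (μ := μ) (ν := ν)
      (fun A' => ((twoTypeModel ε h0 h1).fraction (1 / 2) A' 0 - 4 / 5) ^ 2),
    integral_fun_snd (μ := μ) (ν := ν)
      (fun A => ((arrivalCount A 0 : ℝ) - T * (4 / 5)) ^ 2), hvar']
  simp only [probReal_univ, integral_const, smul_eq_mul, mul_one, one_mul]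
  have e1 : 10000 / (T : ℝ) ^ 2 * (T * (4 / 25)) = 1600 / T := by
    field_simp
    norm_num
  have e2 : (4 : ℝ) / 25 / T = 4 / 25 * (1 / T) := by ring
  have e3 : (1600 : ℝ) / T = 1600 * (1 / T) := by ring
  have e4 : (1 : ℝ) / T ≤ 1 / 4000 := one_div_le_one_div_of_le (by norm_num) hT'
  rw [e1, e3]
  rw [e2] at hvar
  have hc : 0 ≤ ε / 125 * T := by positivity
  calc ε / 250 * T = ε / 125 * T * (1 / 2) := by ring
    _ ≤ _ := mul_le_mul_of_nonneg_left (by linarith) hc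

end TwoType

end Overbooking

theorem mainTheorem9 (ε : ℝ) (h0 : 0 < ε) (h1 : ε < 1 / 2) :
    (∀ T : ℕ, ∃ price : ℝ,
      (Overbooking.twoTypeModel ε h0 h1).IsDualPrice ((T : ℝ) / 2) T price) ∧
    ∃ c : ℝ, 0 < c ∧ ∃ T₀ : ℕ, ∀ T : ℕ, T₀ ≤ T → ∀ M : ℕ, 1 ≤ M → ∀ price : ℝ,
      (Overbooking.twoTypeModel ε h0 h1).IsDualPrice ((T : ℝ) / 2) T price →
        c * T ≤ (Overbooking.twoTypeModel ε h0 h1).dpdLoss ((T : ℝ) / 2) T M price := by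
  refine ⟨fun T => ⟨_, _, Overbooking.twoTypeModel_isDualOptimal_twoTypeDual T, rfl⟩,
    ε / 250, by positivity, 4000, fun T hT M hM price hprice => ?_⟩
  rw [Overbooking.twoTypeModel_dualPrice_eq (by omega) hprice]
  exact Overbooking.twoTypeModel_dpdLoss_ge hM hT
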